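/- Fix integers $r\ge 1$ and $0\le t\le 2r-1$. Consider one kernel iteration of the identification protocol. A private $x$ is uniformly random in $\{1,\dots,2r+1\}$, with phase $\phi=2\pi x/(2r+1)$. An adversary who does not know $x$ holds $t$ black boxes for the one-qubit gate $u_\phi=\mathrm{diag}(1,e^{i\phi})$. Using at most $t$ of them, interleaved with arbitrary phase-independent quantum operations on a register of arbitrary finite dimension, she prepares a system $R$. Then Bob chooses a uniformly random bit $b$ and sends her a qubit $S$ in the state $(|0\rangle+(-1)^b e^{i\phi}|1\rangle)/\sqrt2$, and she answers with the outcome $b'\in\{0,1\}$ of a two-outcome POVM on $R\otimes S$. Let $c=\pi^2/4-\pi^4/48$. Then $c>0$; for every such adversary $$\Pr[b'=b]\le 1-\frac{c}{(t+2)^2};$$ and the maximum of $\Pr[b'=b]$ over all such adversaries is attained and equals exactly $$\frac12+\frac12\cos\frac{\pi}{t+2}.$$ The same bound and the same exact maximum hold, for every integer $t\ge 0$, when $\phi$ is instead uniformly random in $[0,2\pi]$. -/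

import Mathlib

open scoped Kronecker ComplexOrder

noncomputable section

namespace PhaseKey

/-- A density operator on the space with orthonormal basis indexed by `α`. -/
structure DensityOp (α : Type) [Fintype α] [DecidableEq α] where
  mat : Matrix α α ℂ
  posSemidef : mat.PosSemidef
  trace_eq_one : mat.trace = 1

/-- A quantum operation (completely positive trace-preserving map) in operator-sum form:
finitely many Kraus operators `K i` with `∑ i, (K i)ᴴ * K i = 1`. -/
structure QuantumOp (α β : Type) [Fintype α] [DecidableEq α] [Fintype β] [DecidableEq β] where
  num : ℕ
  kraus : Fin num → Matrix β α ℂ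
  tracePreserving : ∑ i, (kraus i).conjTranspose * kraus i = 1

/-- The action `ρ ↦ ∑ i, K i * ρ * (K i)ᴴ` of a quantum operation. -/
def QuantumOp.apply {α β : Type} [Fintype α] [DecidableEq α] [Fintype β] [DecidableEq β]
    (Φ : QuantumOp α β) (ρ : Matrix α α ℂ) : Matrix β β ℂ :=
  ∑ i, Φ.kraus i * ρ * (Φ.kraus i).conjTranspose

/-- A two-outcome generalized measurement (POVM); the outcome is a bit. -/
structure BitPOVM (α : Type) [Fintype α] [DecidableEq α] where
  effect : Fin 2 → Matrix α α ℂ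
  posSemidef : ∀ b, (effect b).PosSemidef
  sum_eq_one : ∑ b, effect b = 1

/-- The one-qubit phase gate `u_φ = diag(1, e^{iφ})`. -/
def phaseGate (φ : ℝ) : Matrix (Fin 2) (Fin 2) ℂ :=
  !![1, 0; 0, Complex.exp (Complex.I * φ)]

/-- The black box for `u_φ`, applied to the first qubit of a register made of one qubit and an
`m`-dimensional memory: `ρ ↦ (u_φ ⊗ 1) ρ (u_φ ⊗ 1)ᴴ`. -/
def blackBox {m : ℕ} (φ : ℝ) (ρ : Matrix (Fin 2 × Fin m) (Fin 2 × Fin m) ℂ) :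
    Matrix (Fin 2 × Fin m) (Fin 2 × Fin m) ℂ :=
  (phaseGate φ ⊗ₖ (1 : Matrix (Fin m) (Fin m) ℂ)) * ρ *
    (phaseGate φ ⊗ₖ (1 : Matrix (Fin m) (Fin m) ℂ)).conjTranspose

/-- The circuits by which the adversary prepares her reference system `R` before she receives
Bob's qubit. A member of `Preparation m n` uses exactly `n` black boxes and ends with a register
made of one qubit and an `m`-dimensional memory. She starts in any state; then, `n` times, a black
box is applied to the qubit and she performs any quantum operation on her whole register, which may
change the (finite) dimension of the memory. Nothing here depends on the phase. -/
inductive Preparation : ℕ → ℕ → Type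
  | init {m : ℕ} (ρ : DensityOp (Fin 2 × Fin m)) : Preparation m 0
  | call {m m' n : ℕ} (P : Preparation m n)
      (Φ : QuantumOp (Fin 2 × Fin m) (Fin 2 × Fin m')) : Preparation m' (n + 1)

/-- The state of `R` that a circuit prepares when its black boxes are for `u_φ`. -/
def Preparation.state (φ : ℝ) :
    {m n : ℕ} → Preparation m n → Matrix (Fin 2 × Fin m) (Fin 2 × Fin m) ℂ
  | _, _, .init ρ => ρ.mat
  | _, _, .call P Φ => Φ.apply (blackBox φ (P.state φ))

/-- The unit vector `(|0⟩ + (-1)^b e^{iφ} |1⟩) / √2`. -/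
def bobKet (φ : ℝ) (b : Fin 2) : Fin 2 → ℂ :=
  ![((√2 : ℝ) : ℂ)⁻¹,
    ((√2 : ℝ) : ℂ)⁻¹ * ((-1) ^ (b : ℕ) * Complex.exp (Complex.I * φ))]

/-- The density operator `|v⟩⟨v|` of the qubit that Bob sends. -/
def bobState (φ : ℝ) (b : Fin 2) : Matrix (Fin 2) (Fin 2) ℂ :=
  Matrix.vecMulVec (bobKet φ b) (star (bobKet φ b))

/-- An adversary for one kernel iteration who has `t` black boxes: she prepares `R` with at most
`t` of them, then receives Bob's qubit `S`, and measures `R ⊗ S` to produce her guess. -/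
structure Attack (t : ℕ) where
  dim : ℕ
  calls : ℕ
  calls_le : calls ≤ t
  prep : Preparation dim calls
  measurement : BitPOVM ((Fin 2 × Fin dim) × Fin 2)

/-- Probability that the adversary answers `b'` when the phase is `φ` and Bob's bit is `b`. -/
def Attack.answerProb {t : ℕ} (A : Attack t) (φ : ℝ) (b b' : Fin 2) : ℝ :=
  (A.measurement.effect b' * (A.prep.state φ ⊗ₖ bobState φ b)).trace.re

/-- Probability that the answer equals Bob's uniformly random bit when the phase is `φ`. -/
def Attack.correctProb {t : ℕ} (A : Attack t) (φ : ℝ) : ℝ :=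
  (1 / 2) * ∑ b : Fin 2, A.answerProb φ b b

/-- Probability of a correct guess in a kernel iteration with reusability parameter `r`:
the private key `x` is uniform in `{1, …, 2r+1}` and the phase is `2πx/(2r+1)`. -/
def Attack.guessProb {t : ℕ} (A : Attack t) (r : ℕ) : ℝ :=
  (1 / (2 * (r : ℝ) + 1)) *
    ∑ x ∈ Finset.Icc 1 (2 * r + 1), A.correctProb (2 * Real.pi * (x : ℝ) / (2 * (r : ℝ) + 1))

/-- Probability of a correct guess when the phase is uniform in `[0, 2π]`. -/
def Attack.guessProbUniform {t : ℕ} (A : Attack t) : ℝ :=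
  (1 / (2 * Real.pi)) * ∫ φ in (0 : ℝ)..(2 * Real.pi), A.correctProb φ

end PhaseKey

end

namespace PhaseKey

open Matrix

/-! Put z = exp(iφ). A black box acts by a polynomial of degree one in z, so after at most t calls
the state of R is a sum of terms F Fᴴ with F of degree at most t in z
(`Preparation.exists_phasePolynomial`). Bob's bit shows only in the off-diagonal block X of the
effect, and his qubit adds one factor z: the gain over 1/2 is Re(z tr(Xρ))
(`Attack.correctProb_eq`). Averaging over the phase keeps frequency zero, that is, the coherences
between neighbouring coefficients of F. The frequencies have absolute value at most t + 1, so 2r + 1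
equally spaced phases serve as well as the full circle when t + 1 ≤ 2r.

X has norm at most 1/2 (`BitPOVM.offDiagonal_bound`), so the gain is at most half the sum of a_k
a_{k+1}, where the a_k are the norms of the coefficients and their squares sum to 1. This is a
quadratic form on the path with t + 1 vertices, with maximum cos(π/(t+2)) (`path_quadratic_bound`).
Equality comes from the superposition of the a_k z^k |k⟩ with a the top eigenvector, measured
through a cyclic shift (`exists_attack_average_eq`). -/

/-! ### Elementary estimates for the constant c -/

lemma cos_le_quartic {x : ℝ} (hx : 0 ≤ x) (hx2 : x ≤ 2) :
    Real.cos x ≤ 1 - x ^ 2 / 2 + x ^ 4 / 24 := by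
  have hs := Real.sin_ge_sub_cube (x := x / 2) (by linarith)
  have hc : Real.cos x = 1 - 2 * Real.sin (x / 2) ^ 2 := by
    have h := Real.cos_sq' (x / 2)
    have h2 := Real.cos_two_mul (x / 2)
    rw [mul_div_cancel₀ x two_ne_zero] at h2
    rw [h2, h]; ring
  have h0 : 0 ≤ x / 2 - (x / 2) ^ 3 / 6 := by
    have : x / 2 - (x / 2) ^ 3 / 6 = x / 2 * (1 - x ^ 2 / 24) := by ring
    rw [this]
    exact mul_nonneg (by linarith) (by nlinarith)
  -- Squaring is allowed since the cubic is nonnegative; the term dropped afterwards is -x^6/1152.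
  have hsq := pow_le_pow_left₀ h0 hs 2
  have h6 : 0 ≤ x ^ 6 := by positivity
  rw [hc]
  nlinarith

lemma bound_constant_pos : 0 < Real.pi ^ 2 / 4 - Real.pi ^ 4 / 48 := by
  have h1 := Real.pi_pos
  have h2 := Real.pi_lt_d2
  have h3 : Real.pi ^ 2 < 12 := by nlinarith
  have : Real.pi ^ 2 / 4 - Real.pi ^ 4 / 48 = Real.pi ^ 2 * (12 - Real.pi ^ 2) / 48 := by ring
  rw [this]
  have : 0 < 12 - Real.pi ^ 2 := by linarith
  positivity

lemma optimum_le (t : ℕ) :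
    1 / 2 + 1 / 2 * Real.cos (Real.pi / ((t : ℝ) + 2)) ≤
      1 - (Real.pi ^ 2 / 4 - Real.pi ^ 4 / 48) / ((t : ℝ) + 2) ^ 2 := by
  have hn : (2 : ℝ) ≤ (t : ℝ) + 2 := by have : (0 : ℝ) ≤ t := Nat.cast_nonneg t; linarith
  generalize (t : ℝ) + 2 = n at hn ⊢
  have hn0 : 0 < n := by linarith
  have hc := cos_le_quartic (x := Real.pi / n) (by positivity)
    (by rw [div_le_iff₀ hn0]; nlinarith [Real.pi_lt_d2])
  -- Weakening n⁴ to n² merges both Taylor terms into the single constant c.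
  have h4 : (Real.pi / n) ^ 4 ≤ Real.pi ^ 4 / n ^ 2 := by
    rw [div_pow]
    exact div_le_div_of_nonneg_left (by positivity) (by positivity)
      (pow_le_pow_right₀ (by linarith) (by norm_num))
  rw [div_pow] at hc
  have : (Real.pi ^ 2 / 4 - Real.pi ^ 4 / 48) / n ^ 2 =
      Real.pi ^ 2 / n ^ 2 / 4 - Real.pi ^ 4 / n ^ 2 / 48 := by ring
  rw [this]
  linarith

/-! ### Averages over the phase -/

/-- `M` sends a trigonometric polynomial of degree at most `d` to its constant coefficient. -/
def IsPhaseAverage (M : (ℝ → ℝ) → ℝ) (d : ℕ) : Prop :=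
  ∀ (ι : Type) (s : Finset ι) (c : ι → ℂ) (n : ι → ℤ), (∀ i ∈ s, |n i| ≤ d) →
    M (fun φ => ∑ i ∈ s, (c i * Complex.exp (Complex.I * φ) ^ n i).re) =
      ∑ i ∈ s, if n i = 0 then (c i).re else 0

/-- A geometric sum over a root of unity w. The only multiple of 2r + 1 with |n| ≤ 2r is 0, so w ≠ 1
for every other n. -/
lemma sum_rootOfUnity_zpow (r : ℕ) {n : ℤ} (hn : |n| ≤ 2 * r) :
    ∑ x ∈ Finset.Icc 1 (2 * r + 1),
      Complex.exp (Complex.I * ((2 * Real.pi * (x : ℝ) / (2 * (r : ℝ) + 1) : ℝ) : ℂ)) ^ n =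
      if n = 0 then 2 * (r : ℂ) + 1 else 0 := by
  split_ifs with h0
  · subst h0; simp
  have hN : (2 * (r : ℂ) + 1) ≠ 0 := by exact_mod_cast Nat.succ_ne_zero (2 * r)
  set w : ℂ := Complex.exp (2 * Real.pi * Complex.I * (n / (2 * r + 1))) with hw
  have hterm : ∀ x : ℕ,
      Complex.exp (Complex.I * ((2 * Real.pi * (x : ℝ) / (2 * (r : ℝ) + 1) : ℝ) : ℂ)) ^ n =
        w ^ x := by
    intro x
    rw [hw, ← Complex.exp_int_mul, ← Complex.exp_nat_mul]
    congr 1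
    push_cast
    field_simp
  have hw1 : w ≠ 1 := by
    rw [hw, Ne, Complex.exp_eq_one_iff]
    rintro ⟨k, hk⟩
    have hpi : (2 * Real.pi * Complex.I : ℂ) ≠ 0 := Complex.two_pi_I_ne_zero
    rw [mul_comm (k : ℂ)] at hk
    have h := mul_left_cancel₀ hpi hk
    rw [div_eq_iff hN] at h
    have h' : n = k * (2 * r + 1) := by exact_mod_cast h
    have : ((2 * r + 1 : ℕ) : ℤ) ∣ n := ⟨k, by rw [h']; push_cast; ring⟩
    exact h0 (Int.eq_zero_of_abs_lt_dvd this (by push_cast; omega))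
  have hwN : w ^ (2 * r + 1) = 1 := by
    rw [hw, ← Complex.exp_nat_mul, Complex.exp_eq_one_iff]
    refine ⟨n, ?_⟩
    push_cast
    field_simp
  simp_rw [hterm]
  rw [← Finset.Ico_add_one_right_eq_Icc, Finset.sum_Ico_eq_sum_range]
  simp_rw [pow_add, ← Finset.mul_sum]
  rw [Nat.add_sub_cancel, geom_sum_eq hw1, hwN]
  simp

lemma isPhaseAverage_discrete (r : ℕ) :
    IsPhaseAverage (fun f => (1 / (2 * (r : ℝ) + 1)) * ∑ x ∈ Finset.Icc 1 (2 * r + 1),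
      f (2 * Real.pi * (x : ℝ) / (2 * (r : ℝ) + 1))) (2 * r) := by
  intro ι s c n hn
  dsimp only
  rw [Finset.sum_comm, Finset.mul_sum]
  refine Finset.sum_congr rfl fun i hi => ?_
  rw [← Complex.re_sum, ← Finset.mul_sum, sum_rootOfUnity_zpow r (by exact_mod_cast hn i hi)]
  split_ifs
  · have h : (2 * (r : ℂ) + 1) = ((2 * (r : ℝ) + 1 : ℝ) : ℂ) := by push_cast; rfl
    rw [h, Complex.re_mul_ofReal]
    field_simp
  · simp

lemma isPhaseAverage_uniform (d : ℕ) :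
    IsPhaseAverage (fun f => (1 / (2 * Real.pi)) * ∫ φ in (0 : ℝ)..(2 * Real.pi), f φ) d := by
  intro ι s c n _
  have hcont : ∀ i, Continuous fun φ : ℝ => c i * Complex.exp (Complex.I * φ) ^ n i := by
    intro i
    simp_rw [← Complex.exp_int_mul]
    fun_prop
  dsimp only
  have hint : ∀ i ∈ s, IntervalIntegrable
      (fun φ : ℝ => (c i * Complex.exp (Complex.I * φ) ^ n i).re) MeasureTheory.volume
      0 (2 * Real.pi) :=
    fun i _ => (Complex.continuous_re.comp (hcont i)).intervalIntegrable _ _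
  rw [intervalIntegral.integral_finsetSum hint, Finset.mul_sum]
  refine Finset.sum_congr rfl fun i _ => ?_
  have hre : ∫ φ in (0 : ℝ)..(2 * Real.pi), (c i * Complex.exp (Complex.I * φ) ^ n i).re =
      (∫ φ in (0 : ℝ)..(2 * Real.pi), c i * Complex.exp (Complex.I * φ) ^ n i).re :=
    Complex.reCLM.intervalIntegral_comp_comm ((hcont i).intervalIntegrable _ _)
  rw [hre]
  split_ifs with h0
  · simp only [h0, zpow_zero, mul_one, intervalIntegral.integral_const, sub_zero]
    rw [Complex.smul_re, smul_eq_mul]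
    field_simp
  · have hc : (n i : ℂ) * Complex.I ≠ 0 := by simp [h0]
    simp_rw [← Complex.exp_int_mul, ← mul_assoc]
    rw [intervalIntegral.integral_const_mul, integral_exp_mul_complex hc]
    have : Complex.exp ((n i : ℂ) * Complex.I * ((2 * Real.pi : ℝ) : ℂ)) = 1 := by
      rw [Complex.exp_eq_one_iff]
      exact ⟨n i, by push_cast; ring⟩
    rw [this]
    simp

lemma IsPhaseAverage.double_sum {M : (ℝ → ℝ) → ℝ} {d t : ℕ} (hM : IsPhaseAverage M d)
    (htd : t ≤ d) (c : ℕ → ℕ → ℂ) :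
    M (fun φ => ∑ k ∈ Finset.range (t + 1), ∑ l ∈ Finset.range (t + 1),
      (c k l * Complex.exp (Complex.I * φ) ^ ((k : ℤ) - l)).re) =
      ∑ k ∈ Finset.range (t + 1), (c k k).re := by
  have h := hM _ (Finset.range (t + 1) ×ˢ Finset.range (t + 1)) (fun p => c p.1 p.2)
    (fun p => (p.1 : ℤ) - p.2) (by
      intro p hp
      simp only [Finset.mem_product, Finset.mem_range] at hp
      rw [abs_le]
      omega)
  simp only [Finset.sum_product] at h
  rw [h]
  simp_rw [sub_eq_zero, Nat.cast_inj, Finset.sum_ite_eq]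
  exact Finset.sum_congr rfl fun k hk => if_pos hk

lemma IsPhaseAverage.const {M : (ℝ → ℝ) → ℝ} {d : ℕ} (hM : IsPhaseAverage M d) (x : ℝ) :
    M (fun _ => x) = x := by
  simpa using hM _ (Finset.univ : Finset Unit) (fun _ => (x : ℂ)) (fun _ => 0) (by simp)

/-- Linearity of `M` is not assumed, so the constant is adjoined to the sum as one more term, of
frequency 0. -/
lemma IsPhaseAverage.const_add {M : (ℝ → ℝ) → ℝ} {d : ℕ} (hM : IsPhaseAverage M d) (x : ℝ)
    {ι : Type} (s : Finset ι) (c : ι → ℂ) (n : ι → ℤ) (hn : ∀ i ∈ s, |n i| ≤ d) :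
    M (fun φ => x + ∑ i ∈ s, (c i * Complex.exp (Complex.I * φ) ^ n i).re) =
      x + ∑ i ∈ s, if n i = 0 then (c i).re else 0 := by
  have h := hM _ (Finset.insertNone s) (fun p => p.elim (x : ℂ) c) (fun p => p.elim 0 n) (by
    intro p hp
    cases p with
    | none => simp
    | some p => exact hn p (Finset.some_mem_insertNone.1 hp))
  simp only [Finset.sum_insertNone, Option.elim_none, Option.elim_some, zpow_zero, mul_one,
    Complex.ofReal_re, if_true] at h
  exact h

/-- The shift by 1 is the factor exp(iφ) from Bob's qubit; it raises the top frequency to t + 1.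
Only l = k + 1 survives, and k = t has no such partner. -/
lemma IsPhaseAverage.const_add_double_sum {M : (ℝ → ℝ) → ℝ} {d t : ℕ} (hM : IsPhaseAverage M d)
    (htd : t + 1 ≤ d) (x : ℝ) (c : ℕ → ℕ → ℂ) :
    M (fun φ => x + ∑ k ∈ Finset.range (t + 1), ∑ l ∈ Finset.range (t + 1),
      (c k l * Complex.exp (Complex.I * φ) ^ ((k : ℤ) + 1 - l)).re) =
      x + ∑ k ∈ Finset.range t, (c k (k + 1)).re := by
  have h := hM.const_add x (Finset.range (t + 1) ×ˢ Finset.range (t + 1)) (fun p => c p.1 p.2)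
    (fun p => (p.1 : ℤ) + 1 - p.2) (by
      intro p hp
      simp only [Finset.mem_product, Finset.mem_range] at hp
      rw [abs_le]
      omega)
  simp only [Finset.sum_product] at h
  rw [h, Finset.sum_range_succ]
  congr 1
  have h1 : ∀ k l : ℕ, ((k : ℤ) + 1 - l = 0) = (k + 1 = l) := fun k l => by
    rw [eq_iff_iff]; omega
  simp_rw [h1, Finset.sum_ite_eq]
  simp only [Finset.mem_range, lt_irrefl, if_false, add_zero]
  exact Finset.sum_congr rfl fun k hk => if_pos (by have := Finset.mem_range.1 hk; omega)

/-! ### The top eigenvalue of the path -/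

lemma sin_path_eigenvector (θ : ℝ) (k : ℕ) :
    Real.sin (k * θ) + Real.sin (((k + 1 + 1 : ℕ) : ℝ) * θ) =
      2 * Real.cos θ * Real.sin (((k + 1 : ℕ) : ℝ) * θ) := by
  have h1 : (k : ℝ) * θ = ((k + 1 : ℕ) : ℝ) * θ - θ := by push_cast; ring
  have h2 : ((k + 1 + 1 : ℕ) : ℝ) * θ = ((k + 1 : ℕ) : ℝ) * θ + θ := by push_cast; ring
  rw [h1, h2, Real.sin_sub, Real.sin_add]
  ring

lemma sin_path_pos {t k : ℕ} (hk : k ≤ t) :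
    0 < Real.sin (((k + 1 : ℕ) : ℝ) * (Real.pi / ((t : ℝ) + 2))) := by
  have ht : (0 : ℝ) < (t : ℝ) + 2 := by positivity
  apply Real.sin_pos_of_pos_of_lt_pi
  · have := Real.pi_pos; positivity
  · rw [← mul_div_assoc, div_lt_iff₀ ht, mul_comm]
    have : ((k + 1 : ℕ) : ℝ) < (t : ℝ) + 2 := by
      have : (k : ℝ) ≤ t := by exact_mod_cast hk
      push_cast; linarith
    exact mul_lt_mul_of_pos_left this Real.pi_pos

lemma sin_path_end (t : ℕ) :
    Real.sin (((t + 1 + 1 : ℕ) : ℝ) * (Real.pi / ((t : ℝ) + 2))) = 0 := by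
  have : ((t + 1 + 1 : ℕ) : ℝ) * (Real.pi / ((t : ℝ) + 2)) = Real.pi := by
    push_cast; field_simp; ring
  rw [this, Real.sin_pi]

/-- The largest eigenvalue of the path with `t + 1` vertices bounds its quadratic form. -/
lemma path_quadratic_bound (t : ℕ) (A c : ℕ → ℝ)
    (h : ∀ k < t, ∀ μ ν : ℝ, 4 * (μ * ν) * c k ≤ μ ^ 2 * A (k + 1) + ν ^ 2 * A k) :
    ∑ k ∈ Finset.range t, c k ≤
      1 / 2 * Real.cos (Real.pi / ((t : ℝ) + 2)) * ∑ k ∈ Finset.range (t + 1), A k := by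
  set θ := Real.pi / ((t : ℝ) + 2)
  set s : ℕ → ℝ := fun k => Real.sin ((k : ℝ) * θ) with hs
  have hpos : ∀ k ≤ t, 0 < s (k + 1) := fun k hk => sin_path_pos hk
  have h0 : s 0 = 0 := by simp [hs]
  have hend : s (t + 1 + 1) = 0 := sin_path_end t
  -- The multipliers in `h` are neighbouring entries of the positive eigenvector.
  have hterm : ∀ k < t, 4 * c k ≤ s (k + 1) / s (k + 1 + 1) * A (k + 1) +
      s (k + 1 + 1) / s (k + 1) * A k := by
    intro k hk
    have h1 := hpos k hk.le
    have h2 := hpos (k + 1) hk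
    have := h k hk (s (k + 1)) (s (k + 1 + 1))
    have e : s (k + 1) / s (k + 1 + 1) * A (k + 1) + s (k + 1 + 1) / s (k + 1) * A k =
        (s (k + 1) ^ 2 * A (k + 1) + s (k + 1 + 1) ^ 2 * A k) /
          (s (k + 1) * s (k + 1 + 1)) := by
      field_simp
    rw [e, le_div_iff₀ (mul_pos h1 h2)]
    linarith
  -- Because `s` vanishes at 0 and t + 2, both sums extend to all vertices, and the eigenvector
  -- equation gives every A k the same coefficient.
  have hsum : 4 * ∑ k ∈ Finset.range t, c k ≤ ∑ k ∈ Finset.range (t + 1),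
      (s k / s (k + 1) * A k + s (k + 1 + 1) / s (k + 1) * A k) := by
    rw [Finset.sum_add_distrib, Finset.sum_range_succ', h0,
      Finset.sum_range_succ (fun k => s (k + 1 + 1) / s (k + 1) * A k), hend, Finset.mul_sum]
    simp only [zero_div, zero_mul, add_zero]
    rw [← Finset.sum_add_distrib]
    exact Finset.sum_le_sum fun k hk => hterm k (Finset.mem_range.1 hk)
  have heq : ∑ k ∈ Finset.range (t + 1),
      (s k / s (k + 1) * A k + s (k + 1 + 1) / s (k + 1) * A k) =
      2 * Real.cos θ * ∑ k ∈ Finset.range (t + 1), A k := by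
    rw [Finset.mul_sum]
    refine Finset.sum_congr rfl fun k hk => ?_
    have h1 := hpos k (Nat.lt_succ_iff.1 (Finset.mem_range.1 hk))
    rw [← add_mul, ← add_div, sin_path_eigenvector θ k, mul_div_assoc, div_self h1.ne', mul_one]
  rw [heq] at hsum
  linarith

/-- The path with `t + 1` vertices has a unit eigenvector for its largest eigenvalue. -/
lemma exists_path_eigenvector (t : ℕ) : ∃ a : ℕ → ℝ,
    ∑ k ∈ Finset.range (t + 1), a k ^ 2 = 1 ∧
    ∑ k ∈ Finset.range t, a k * a (k + 1) = Real.cos (Real.pi / ((t : ℝ) + 2)) := by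
  set θ := Real.pi / ((t : ℝ) + 2)
  set s : ℕ → ℝ := fun k => Real.sin ((k : ℝ) * θ) with hs
  set S : ℝ := ∑ k ∈ Finset.range (t + 1), s (k + 1) ^ 2
  have hS : 0 < S := Finset.sum_pos
    (fun k hk => pow_pos (sin_path_pos (Nat.lt_succ_iff.1 (Finset.mem_range.1 hk))) 2) (by simp)
  have h0 : s 0 = 0 := by simp [hs]
  have hend : s (t + 1 + 1) = 0 := sin_path_end t
  -- Pairing the eigenvector equation with `s` counts each edge twice.
  have key : ∑ k ∈ Finset.range t, s (k + 1) * s (k + 1 + 1) = Real.cos θ * S := by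
    have h1 : ∑ k ∈ Finset.range (t + 1), s (k + 1) * (s k + s (k + 1 + 1)) =
        2 * Real.cos θ * S := by
      rw [Finset.mul_sum]
      refine Finset.sum_congr rfl fun k _ => ?_
      rw [sin_path_eigenvector θ k]
      ring
    simp_rw [mul_add] at h1
    rw [Finset.sum_add_distrib, Finset.sum_range_succ', h0,
      Finset.sum_range_succ (fun k => s (k + 1) * s (k + 1 + 1)), hend] at h1
    simp only [mul_zero, add_zero] at h1
    have h2 : ∑ k ∈ Finset.range t, s (k + 1 + 1) * s (k + 1) =
        ∑ k ∈ Finset.range t, s (k + 1) * s (k + 1 + 1) :=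
      Finset.sum_congr rfl fun k _ => mul_comm _ _
    linarith
  refine ⟨fun k => s (k + 1) / √S, ?_, ?_⟩
  · simp_rw [div_pow, Real.sq_sqrt hS.le, ← Finset.sum_div]
    exact div_self hS.ne'
  · simp_rw [div_mul_div_comm, Real.mul_self_sqrt hS.le, ← Finset.sum_div]
    rw [key, mul_div_assoc, div_self hS.ne', mul_one]

/-! ### States as polynomials in exp(iφ) -/

/-- `F φ` is a polynomial of degree at most `n` in `exp (iφ)` with matrix coefficients. -/
def IsPhasePolynomial {α β : Type} (n : ℕ) (F : ℝ → Matrix α β ℂ) : Prop :=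
  ∃ W : ℕ → Matrix α β ℂ,
    ∀ φ : ℝ, F φ = ∑ k ∈ Finset.range (n + 1), Complex.exp (Complex.I * φ) ^ k • W k

namespace IsPhasePolynomial

variable {α β γ : Type} {n : ℕ} {F G : ℝ → Matrix α β ℂ}

lemma const (A : Matrix α β ℂ) : IsPhasePolynomial 0 fun _ => A :=
  ⟨fun _ => A, fun φ => by simp⟩

lemma mono {m : ℕ} (hnm : n ≤ m) (h : IsPhasePolynomial n F) : IsPhasePolynomial m F := by
  obtain ⟨W, hW⟩ := h
  -- Coefficients beyond index `n` are arbitrary, so they are replaced by zero.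
  refine ⟨fun k => if k ∈ Finset.range (n + 1) then W k else 0, fun φ => ?_⟩
  rw [hW, ← Finset.sum_subset (Finset.range_subset_range.2 (Nat.succ_le_succ hnm))]
  · exact Finset.sum_congr rfl fun k hk => (congrArg _ (if_pos hk)).symm
  · intro k _ hk
    exact (congrArg _ (if_neg hk)).trans (smul_zero _)

lemma add (hF : IsPhasePolynomial n F) (hG : IsPhasePolynomial n G) :
    IsPhasePolynomial n fun φ => F φ + G φ := by
  obtain ⟨V, hV⟩ := hF
  obtain ⟨W, hW⟩ := hG
  exact ⟨fun k => V k + W k, fun φ => by simp [hV, hW, smul_add, Finset.sum_add_distrib]⟩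

lemma const_mul [Fintype α] (A : Matrix γ α ℂ) (h : IsPhasePolynomial n F) :
    IsPhasePolynomial n fun φ => A * F φ := by
  obtain ⟨W, hW⟩ := h
  exact ⟨fun k => A * W k, fun φ => by simp [hW, Matrix.mul_sum]⟩

lemma exp_smul (h : IsPhasePolynomial n F) :
    IsPhasePolynomial (n + 1) fun φ => Complex.exp (Complex.I * φ) • F φ := by
  obtain ⟨W, hW⟩ := h
  refine ⟨fun k => k.casesOn 0 W, fun φ => ?_⟩
  simp [Finset.sum_range_succ' _ (n + 1), hW, Finset.smul_sum, smul_smul, pow_succ']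

end IsPhasePolynomial

lemma phaseGate_eq (φ : ℝ) : phaseGate φ =
    !![1, 0; 0, 0] + Complex.exp (Complex.I * φ) • !![0, 0; 0, 1] := by
  ext i j
  fin_cases i <;> fin_cases j <;> simp [phaseGate]

/-- The states that a circuit prepares with `n` black boxes have a decomposition whose
amplitudes are polynomials of degree at most `n` in `exp (iφ)`. -/
lemma Preparation.exists_phasePolynomial {m n : ℕ} (P : Preparation m n) :
    ∃ (I C : Type) (_ : Fintype I) (_ : Fintype C) (F : I → ℝ → Matrix (Fin 2 × Fin m) C ℂ),
      (∀ i, IsPhasePolynomial n (F i)) ∧ ∀ φ, P.state φ = ∑ i, F i φ * (F i φ)ᴴ := by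
  induction P with
  | init ρ =>
    obtain ⟨B, hB⟩ : ∃ B : Matrix _ _ ℂ, ρ.mat = B * Bᴴ := by
      open scoped MatrixOrder in
      obtain ⟨B, hB⟩ := CStarAlgebra.nonneg_iff_eq_mul_star_self.1 ρ.posSemidef.nonneg
      exact ⟨B, hB⟩
    exact ⟨Unit, _, inferInstance, inferInstance, fun _ _ => B, fun _ => .const B,
      fun φ => by simpa [Preparation.state] using hB⟩
  | @call m m' n P Φ ih =>
    obtain ⟨I, C, _, _, F, hF, hP⟩ := ih
    -- Kraus operators are free of the phase; only the gate, split as a constant plus exp(iφ) times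
    -- a constant, raises the degree.
    refine ⟨Fin Φ.num × I, C, inferInstance, inferInstance, fun p φ => Φ.kraus p.1 *
      ((phaseGate φ ⊗ₖ (1 : Matrix (Fin m) (Fin m) ℂ)) * F p.2 φ), fun p => ?_, fun φ => ?_⟩
    · refine IsPhasePolynomial.const_mul _ ?_
      simp_rw [phaseGate_eq, Matrix.add_kronecker, Matrix.smul_kronecker, Matrix.add_mul,
        Matrix.smul_mul]
      exact (((hF p.2).const_mul _).mono (Nat.le_succ n)).add ((hF p.2).const_mul _).exp_smul
    · simp only [Preparation.state, QuantumOp.apply, blackBox, hP, Fintype.sum_prod_type,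
        Matrix.mul_sum, Matrix.sum_mul, Matrix.conjTranspose_mul, Matrix.mul_assoc]

lemma exp_I_mul_star (φ : ℝ) :
    star (Complex.exp (Complex.I * φ)) = (Complex.exp (Complex.I * φ))⁻¹ := by
  rw [← Complex.exp_neg, Complex.star_def, ← Complex.exp_conj]
  simp

lemma trace_phaseGate_conj {m : ℕ} (φ : ℝ) (ρ : Matrix (Fin 2 × Fin m) (Fin 2 × Fin m) ℂ) :
    (blackBox φ ρ).trace = ρ.trace := by
  have h : (phaseGate φ)ᴴ * phaseGate φ = 1 := by
    have h1 := exp_I_mul_star φ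
    rw [Complex.star_def] at h1
    ext i j
    fin_cases i <;> fin_cases j <;> simp [phaseGate, Matrix.mul_apply, h1]
  rw [blackBox, Matrix.trace_mul_cycle, Matrix.conjTranspose_kronecker,
    ← Matrix.mul_kronecker_mul, h, Matrix.conjTranspose_one, Matrix.one_mul,
    Matrix.one_kronecker_one, Matrix.one_mul]

lemma QuantumOp.trace_apply {α β : Type} [Fintype α] [DecidableEq α] [Fintype β] [DecidableEq β]
    (Φ : QuantumOp α β) (ρ : Matrix α α ℂ) : (Φ.apply ρ).trace = ρ.trace := by
  rw [QuantumOp.apply, Matrix.trace_sum]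
  have h : ∀ i, (Φ.kraus i * ρ * (Φ.kraus i)ᴴ).trace = ((Φ.kraus i)ᴴ * Φ.kraus i * ρ).trace :=
    fun i => Matrix.trace_mul_cycle _ _ _
  simp_rw [h]
  rw [← Matrix.trace_sum, ← Matrix.sum_mul, Φ.tracePreserving, Matrix.one_mul]

lemma Preparation.trace_state (φ : ℝ) {m n : ℕ} (P : Preparation m n) :
    (P.state φ).trace = 1 := by
  induction P with
  | init ρ => exact ρ.trace_eq_one
  | call P Φ ih =>
    rw [Preparation.state, QuantumOp.trace_apply, trace_phaseGate_conj, ih]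

/-! ### Bob's qubit and the measurement -/

/-- The off-diagonal block, with respect to Bob's qubit, of the effect for outcome `0`. -/
def BitPOVM.offDiagonal {α : Type} [Fintype α] [DecidableEq α] (E : BitPOVM (α × Fin 2)) :
    Matrix α α ℂ :=
  (E.effect 0).submatrix (fun r => (r, 0)) fun r => (r, 1)

lemma BitPOVM.effect_one {α : Type} [Fintype α] [DecidableEq α] (E : BitPOVM α) :
    E.effect 1 = 1 - E.effect 0 := by
  rw [← E.sum_eq_one, Fin.sum_univ_two, add_sub_cancel_left]

lemma trace_mul_kronecker_bit {α : Type} [Fintype α] (E : Matrix (α × Fin 2) (α × Fin 2) ℂ)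
    (ρ : Matrix α α ℂ) (β : Matrix (Fin 2) (Fin 2) ℂ) :
    (E * (ρ ⊗ₖ β)).trace = ∑ s, ∑ s',
      β s' s * (E.submatrix (fun r => (r, s)) (fun r => (r, s')) * ρ).trace := by
  simp only [Matrix.trace, Matrix.diag_apply, Matrix.mul_apply, Fintype.sum_prod_type,
    Matrix.kroneckerMap_apply, Matrix.submatrix_apply, Finset.mul_sum]
  rw [Finset.sum_comm]
  refine Finset.sum_congr rfl fun s _ => ?_
  rw [Finset.sum_comm]
  simp only [Fin.sum_univ_two, ← Finset.sum_add_distrib]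
  rw [Finset.sum_comm]
  refine Finset.sum_congr rfl fun a _ => Finset.sum_congr rfl fun b _ => ?_
  ring

lemma bobState_eq (φ : ℝ) (b : Fin 2) : bobState φ b = (1 / 2 : ℂ) •
    !![1, (-1) ^ (b : ℕ) * (Complex.exp (Complex.I * φ))⁻¹;
      (-1) ^ (b : ℕ) * Complex.exp (Complex.I * φ), 1] := by
  have h2 : ((√2 : ℝ) : ℂ)⁻¹ * ((√2 : ℝ) : ℂ)⁻¹ = 1 / 2 := by
    rw [← mul_inv, ← Complex.ofReal_mul, Real.mul_self_sqrt (by norm_num)]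
    norm_num
  have hs : star (((√2 : ℝ) : ℂ)⁻¹) = ((√2 : ℝ) : ℂ)⁻¹ := by
    rw [← Complex.ofReal_inv]; exact Complex.conj_ofReal _
  have hb : ((-1 : ℂ) ^ (b : ℕ)) * (-1 : ℂ) ^ (b : ℕ) = 1 := by
    rw [← mul_pow]; simp
  have hsb : star ((-1 : ℂ) ^ (b : ℕ)) = (-1 : ℂ) ^ (b : ℕ) := by simp
  have hz := mul_inv_cancel₀ (Complex.exp_ne_zero (Complex.I * φ))
  rw [bobState, ← h2]
  ext i j
  rw [Matrix.vecMulVec_apply, Pi.star_apply]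
  fin_cases i <;> fin_cases j <;>
    simp only [bobKet, Fin.zero_eta, Fin.mk_one, Matrix.cons_val_zero, Matrix.cons_val_one,
      Matrix.cons_val_fin_one, Matrix.smul_apply, Matrix.of_apply, Matrix.cons_val', smul_eq_mul,
      star_mul', hs, hsb, exp_I_mul_star]
  · ring
  · ring
  · ring
  · generalize Complex.exp (Complex.I * φ) = z at hz
    generalize ((√2 : ℝ) : ℂ)⁻¹ = w
    linear_combination w * w * (-1 : ℂ) ^ (b : ℕ) * (-1 : ℂ) ^ (b : ℕ) * hz + w * w * hb

lemma bobState_zero_sub_one (φ : ℝ) : bobState φ 0 - bobState φ 1 =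
    !![0, (Complex.exp (Complex.I * φ))⁻¹; Complex.exp (Complex.I * φ), 0] := by
  rw [bobState_eq, bobState_eq]
  ext i j
  fin_cases i <;> fin_cases j <;> simp <;> ring

lemma bobState_trace (φ : ℝ) (b : Fin 2) : (bobState φ b).trace = 1 := by
  rw [bobState_eq, Matrix.trace_smul, Matrix.trace_fin_two_of]
  norm_num

/-- Any attack beats a coin flip by its coherence between neighbouring frequencies. -/
lemma Attack.correctProb_eq {t : ℕ} (A : Attack t) (φ : ℝ) (hρ : (A.prep.state φ).IsHermitian) :
    A.correctProb φ = 1 / 2 + (Complex.exp (Complex.I * φ) *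
      (A.measurement.offDiagonal * A.prep.state φ).trace).re := by
  set ρ := A.prep.state φ with hdef
  set E := A.measurement.effect 0 with hE
  set X := A.measurement.offDiagonal with hX
  have h1 : A.correctProb φ =
      1 / 2 + 1 / 2 * (E * (ρ ⊗ₖ (bobState φ 0 - bobState φ 1))).trace.re := by
    have hk : ρ ⊗ₖ (bobState φ 0 - bobState φ 1) =
        ρ ⊗ₖ bobState φ 0 - ρ ⊗ₖ bobState φ 1 := by
      ext i j
      simp only [Matrix.kroneckerMap_apply, Matrix.sub_apply, mul_sub]
    have htr : (ρ ⊗ₖ bobState φ 1).trace = 1 := by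
      rw [Matrix.trace_kronecker, A.prep.trace_state, bobState_trace, one_mul]
    rw [Attack.correctProb, Fin.sum_univ_two, Attack.answerProb, Attack.answerProb,
      A.measurement.effect_one, ← hE, ← hdef, hk, Matrix.mul_sub, Matrix.sub_mul,
      Matrix.one_mul, Matrix.trace_sub, Matrix.trace_sub, htr]
    simp only [Complex.sub_re, Complex.one_re]
    ring
  have h10 : E.submatrix (fun r => (r, 1)) (fun r => (r, 0)) = Xᴴ := by
    rw [hX, BitPOVM.offDiagonal, Matrix.conjTranspose_submatrix, ← hE,
      (A.measurement.posSemidef 0).isHermitian.eq]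
  have h01 : E.submatrix (fun r => (r, 0)) (fun r => (r, 1)) = X := rfl
  have hstar : (Xᴴ * ρ).trace = star (X * ρ).trace := by
    rw [← Matrix.trace_conjTranspose, Matrix.conjTranspose_mul, hρ.eq, Matrix.trace_mul_comm]
  rw [h1, trace_mul_kronecker_bit, bobState_zero_sub_one]
  simp only [Fin.sum_univ_two, Matrix.of_apply, Matrix.cons_val', Matrix.cons_val_zero,
    Matrix.cons_val_one, Matrix.cons_val_fin_one, zero_mul, zero_add, add_zero]
  -- The two off-diagonal contributions are complex conjugates, so half their sum is a real part.
  rw [h01, h10, hstar, ← exp_I_mul_star, ← star_mul', Complex.add_re, Complex.star_def,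
    Complex.conj_re]
  ring

/-- The off-diagonal block of an effect has norm at most `1 / 2`. -/
lemma BitPOVM.offDiagonal_bound {α γ : Type} [Fintype α] [DecidableEq α] [Fintype γ]
    (E : BitPOVM (α × Fin 2)) (U V : Matrix α γ ℂ) :
    4 * (Uᴴ * E.offDiagonal * V).trace.re ≤ (Uᴴ * U).trace.re + (Vᴴ * V).trace.re := by
  set J : Fin 2 → Matrix (α × Fin 2) α ℂ := fun s => (1 : Matrix _ _ ℂ).submatrix id fun r => (r, s)
  have hblock : ∀ (B : Matrix (α × Fin 2) (α × Fin 2) ℂ) (s s' : Fin 2),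
      (J s)ᴴ * B * J s' = B.submatrix (fun r => (r, s)) fun r => (r, s') := by
    intro B s s'
    ext r r'
    simp [J, Matrix.mul_apply, Matrix.one_apply]
  have hJ : ∀ s s', (J s)ᴴ * J s' = if s = s' then 1 else 0 := by
    intro s s'
    have := hblock 1 s s'
    rw [Matrix.mul_one] at this
    rw [this]
    ext r r'
    by_cases h : s = s' <;> simp [Matrix.one_apply, h]
  have hnn : ∀ {B : Matrix (α × Fin 2) (α × Fin 2) ℂ}, B.PosSemidef →
      ∀ Z : Matrix (α × Fin 2) γ ℂ, 0 ≤ (Zᴴ * B * Z).trace.re := fun hB Z =>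
    (Complex.le_def.1 (hB.conjTranspose_mul_mul_same Z).trace_nonneg).1
  -- Opposite signs for the two effects make the cross terms add up, while the diagonal terms
  -- combine through E₀ + E₁ = 1.
  have h0 := hnn (E.posSemidef 0) (J 0 * U - J 1 * V)
  have h1 := hnn (E.posSemidef 1) (J 0 * U + J 1 * V)
  have key : (((J 0 * U - J 1 * V)ᴴ * E.effect 0 * (J 0 * U - J 1 * V)) +
      ((J 0 * U + J 1 * V)ᴴ * E.effect 1 * (J 0 * U + J 1 * V))) =
      Uᴴ * U + Vᴴ * V - (2 : ℂ) • (Uᴴ * E.offDiagonal * V) -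
        (2 : ℂ) • (Uᴴ * E.offDiagonal * V)ᴴ := by
    have hX : E.offDiagonal = (J 0)ᴴ * E.effect 0 * J 1 := (hblock _ _ _).symm
    have hE : (E.effect 0)ᴴ = E.effect 0 := (E.posSemidef 0).isHermitian
    have e00 := hJ 0 0
    have e01 := hJ 0 1
    have e10 := hJ 1 0
    have e11 := hJ 1 1
    rw [if_pos rfl] at e00 e11
    rw [if_neg (by decide)] at e01 e10
    have f : ∀ s s' (Y : Matrix α γ ℂ), (J s)ᴴ * (J s' * Y) = ((J s)ᴴ * J s') * Y :=
      fun s s' Y => (Matrix.mul_assoc _ _ _).symm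
    rw [E.effect_one, hX]
    simp only [Matrix.conjTranspose_add, Matrix.conjTranspose_sub, Matrix.conjTranspose_mul,
      Matrix.conjTranspose_conjTranspose, hE, Matrix.mul_add, Matrix.add_mul, Matrix.mul_sub,
      Matrix.sub_mul, Matrix.mul_one, Matrix.mul_assoc, f, e00, e01, e10, e11, Matrix.one_mul,
      Matrix.zero_mul, Matrix.mul_zero, two_smul]
    abel
  have hk := congrArg (fun Z => (Matrix.trace Z).re) key
  simp only [Matrix.trace_add, Matrix.trace_sub, Matrix.trace_smul, Matrix.trace_conjTranspose,
    Complex.add_re, Complex.sub_re, smul_eq_mul, Complex.mul_re, Complex.star_def,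
    Complex.conj_re, Complex.re_ofNat, Complex.im_ofNat, zero_mul, sub_zero] at hk
  linarith

/-! ### The upper bound -/

lemma Preparation.state_isHermitian (φ : ℝ) {m n : ℕ} (P : Preparation m n) :
    (P.state φ).IsHermitian := by
  obtain ⟨I, C, _, _, F, -, hP⟩ := P.exists_phasePolynomial
  rw [hP, Matrix.IsHermitian, Matrix.conjTranspose_sum]
  simp

lemma phaseSum_mul_conjTranspose {α γ : Type} [Fintype γ] (t : ℕ) (W : ℕ → Matrix α γ ℂ)
    (φ : ℝ) :
    (∑ k ∈ Finset.range (t + 1), Complex.exp (Complex.I * φ) ^ k • W k) *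
        (∑ k ∈ Finset.range (t + 1), Complex.exp (Complex.I * φ) ^ k • W k)ᴴ =
      ∑ k ∈ Finset.range (t + 1), ∑ l ∈ Finset.range (t + 1),
        Complex.exp (Complex.I * φ) ^ ((k : ℤ) - l) • (W k * (W l)ᴴ) := by
  rw [Matrix.conjTranspose_sum, Matrix.sum_mul]
  refine Finset.sum_congr rfl fun k _ => ?_
  rw [Matrix.mul_sum]
  refine Finset.sum_congr rfl fun l _ => ?_
  rw [Matrix.conjTranspose_smul, Matrix.smul_mul, Matrix.mul_smul, smul_smul, star_pow,
    exp_I_mul_star, zpow_sub₀ (Complex.exp_ne_zero _), zpow_natCast, zpow_natCast, inv_pow,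
    div_eq_mul_inv]

/-- No attack exceeds the optimum. -/
lemma Attack.average_le {M : (ℝ → ℝ) → ℝ} {d t : ℕ} (hM : IsPhaseAverage M d) (htd : t + 1 ≤ d)
    (A : Attack t) :
    M A.correctProb ≤ 1 / 2 + 1 / 2 * Real.cos (Real.pi / ((t : ℝ) + 2)) := by
  obtain ⟨I, C, _, _, F, hF, hP⟩ := A.prep.exists_phasePolynomial
  choose W hW using fun i => (hF i).mono A.calls_le
  set X := A.measurement.offDiagonal
  have htrace : ∀ (B : Matrix (Fin 2 × Fin A.dim) (Fin 2 × Fin A.dim) ℂ) (φ : ℝ),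
      (B * A.prep.state φ).trace = ∑ k ∈ Finset.range (t + 1), ∑ l ∈ Finset.range (t + 1),
        (∑ i, (B * (W i k * (W i l)ᴴ)).trace) *
          Complex.exp (Complex.I * φ) ^ ((k : ℤ) - l) := by
    intro B φ
    rw [hP]
    simp_rw [hW, phaseSum_mul_conjTranspose, Matrix.mul_sum, Matrix.trace_sum]
    rw [Finset.sum_comm]
    refine Finset.sum_congr rfl fun k _ => ?_
    rw [Finset.sum_comm]
    refine Finset.sum_congr rfl fun l _ => ?_
    rw [Finset.sum_mul]
    refine Finset.sum_congr rfl fun i _ => ?_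
    rw [Matrix.mul_smul, Matrix.trace_smul, smul_eq_mul, mul_comm]
  have hcorrect : A.correctProb = fun φ : ℝ => 1 / 2 + ∑ k ∈ Finset.range (t + 1),
      ∑ l ∈ Finset.range (t + 1), ((∑ i, (X * (W i k * (W i l)ᴴ)).trace) *
        Complex.exp (Complex.I * φ) ^ ((k : ℤ) + 1 - l)).re := by
    funext φ
    rw [A.correctProb_eq φ (A.prep.state_isHermitian φ), htrace, Finset.mul_sum, Complex.re_sum]
    congr 1
    refine Finset.sum_congr rfl fun k _ => ?_
    rw [Finset.mul_sum, Complex.re_sum]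
    refine Finset.sum_congr rfl fun l _ => ?_
    rw [show (k : ℤ) + 1 - l = 1 + (k - l) by ring, zpow_add₀ (Complex.exp_ne_zero _), zpow_one]
    congr 1
    ring
  -- The trace of the state is 1 at every phase; averaging it leaves the total weight of the
  -- coefficients.
  have hnorm : ∑ k ∈ Finset.range (t + 1), (∑ i, ((W i k)ᴴ * W i k).trace).re = 1 := by
    have h1 : (fun _ : ℝ => (1 : ℝ)) = fun φ : ℝ => ∑ k ∈ Finset.range (t + 1),
        ∑ l ∈ Finset.range (t + 1), ((∑ i, (1 * (W i k * (W i l)ᴴ)).trace) *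
          Complex.exp (Complex.I * φ) ^ ((k : ℤ) - l)).re := by
      funext φ
      have := htrace 1 φ
      rw [Matrix.one_mul, A.prep.trace_state] at this
      rw [← Complex.one_re, this, Complex.re_sum]
      simp_rw [Complex.re_sum]
    have h2 := hM.const 1
    rw [h1, hM.double_sum (by omega)] at h2
    simpa only [Matrix.one_mul, Matrix.trace_mul_comm (W _ _)] using h2
  rw [hcorrect, hM.const_add_double_sum htd]
  have hb := path_quadratic_bound t (fun k => (∑ i, ((W i k)ᴴ * W i k).trace).re)
    (fun k => (∑ i, (X * (W i k * (W i (k + 1))ᴴ)).trace).re) (by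
      intro k _ μ ν
      simp only [Complex.re_sum, Finset.mul_sum]
      rw [← Finset.sum_add_distrib]
      refine Finset.sum_le_sum fun i _ => ?_
      have h := A.measurement.offDiagonal_bound ((μ : ℂ) • W i (k + 1)) ((ν : ℂ) • W i k)
      have hcyc : ((W i (k + 1))ᴴ * X * W i k).trace = (X * (W i k * (W i (k + 1))ᴴ)).trace := by
        rw [Matrix.mul_assoc, Matrix.trace_mul_comm, Matrix.mul_assoc]
      simp only [Matrix.conjTranspose_smul, Matrix.smul_mul, Matrix.mul_smul, smul_smul,
        Matrix.trace_smul, Complex.star_def, Complex.conj_ofReal, smul_eq_mul] at h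
      rw [hcyc, ← Complex.ofReal_mul, ← Complex.ofReal_mul, ← Complex.ofReal_mul,
        Complex.re_ofReal_mul, Complex.re_ofReal_mul, Complex.re_ofReal_mul] at h
      linarith)
  rw [hnorm, mul_one] at hb
  linarith

/-! ### The optimal attack -/

/-- The permutation of basis states as a quantum operation. -/
noncomputable def QuantumOp.ofPerm {α : Type} [Fintype α] [DecidableEq α] (σ : Equiv.Perm α) :
    QuantumOp α α where
  num := 1
  kraus _ := (1 : Matrix α α ℂ).submatrix σ id
  tracePreserving := by
    rw [Fin.sum_univ_one, Matrix.conjTranspose_submatrix, Matrix.conjTranspose_one,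
      Matrix.submatrix_mul_equiv, Matrix.one_mul, Matrix.submatrix_id_id]

lemma QuantumOp.ofPerm_apply {α : Type} [Fintype α] [DecidableEq α] (σ : Equiv.Perm α)
    (ρ : Matrix α α ℂ) : (QuantumOp.ofPerm σ).apply ρ = ρ.submatrix σ σ := by
  have h : (QuantumOp.ofPerm σ).apply ρ = (1 : Matrix α α ℂ).submatrix σ id * ρ *
      ((1 : Matrix α α ℂ).submatrix σ id)ᴴ := Fin.sum_univ_one _
  rw [h]
  ext i j
  simp [Matrix.mul_apply, Matrix.one_apply]

lemma blackBox_apply {m : ℕ} (φ : ℝ) (ρ : Matrix (Fin 2 × Fin m) (Fin 2 × Fin m) ℂ)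
    (p q : Fin 2 × Fin m) : blackBox φ ρ p q =
      Complex.exp (Complex.I * φ) ^ (p.1 : ℕ) * ρ p q *
        star (Complex.exp (Complex.I * φ) ^ (q.1 : ℕ)) := by
  have h : phaseGate φ ⊗ₖ (1 : Matrix (Fin m) (Fin m) ℂ) =
      Matrix.diagonal fun p => Complex.exp (Complex.I * φ) ^ (p.1 : ℕ) := by
    have h2 : phaseGate φ = Matrix.diagonal fun i : Fin 2 => Complex.exp (Complex.I * φ) ^ (i : ℕ) := by
      ext i j
      fin_cases i <;> fin_cases j <;> simp [phaseGate]
    rw [h2, ← Matrix.diagonal_one, Matrix.diagonal_kronecker_diagonal]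
    simp
  rw [blackBox, h, Matrix.diagonal_conjTranspose, Matrix.mul_diagonal, Matrix.diagonal_mul,
    Pi.star_apply]

/-- The measurement of an observable that permutes the basis states and squares to one. -/
noncomputable def BitPOVM.ofInvolution {α : Type} [Fintype α] [DecidableEq α] (σ : Equiv.Perm α)
    (hσ : Function.Involutive σ) : BitPOVM α where
  effect b := (1 / 2 : ℂ) • (1 + (-1 : ℂ) ^ (b : ℕ) • (1 : Matrix α α ℂ).submatrix σ id)
  posSemidef b := by
    set H := (1 : Matrix α α ℂ).submatrix σ id with hH
    have h1 : Hᴴ = H := by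
      ext i j
      have hij : σ j = i ↔ σ i = j := ⟨fun h => by rw [← h, hσ], fun h => by rw [← h, hσ]⟩
      simp [hH, Matrix.one_apply, hij, apply_ite]
    have h2 : H * H = 1 := by
      have h3 : H * H = H.submatrix σ id := by
        ext i j
        rw [Matrix.mul_apply, Finset.sum_eq_single (σ i)]
        · change (1 : Matrix α α ℂ) (σ i) (σ i) * (1 : Matrix α α ℂ) (σ (σ i)) j =
            (1 : Matrix α α ℂ) (σ (σ i)) j
          rw [Matrix.one_apply_eq, one_mul]
        · intro k _ hk
          simp [hH, Matrix.one_apply, hk.symm]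
        · simp
      ext i j
      rw [h3]
      simp [hH, hσ i, Matrix.one_apply]
    have hb : ((-1 : ℂ) ^ (b : ℕ)) * (-1 : ℂ) ^ (b : ℕ) = 1 := by
      rw [← mul_pow]; simp
    set e : ℂ := (-1) ^ (b : ℕ) with he
    have hse : star e = e := by simp [he]
    -- A Hermitian idempotent P equals Pᴴ P.
    have key : (1 / 2 : ℂ) • (1 + e • H) =
        ((1 / 2 : ℂ) • (1 + e • H))ᴴ * ((1 / 2 : ℂ) • (1 + e • H)) := by
      have hhalf : star (1 / 2 : ℂ) = 1 / 2 := by simp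
      rw [Matrix.conjTranspose_smul, Matrix.conjTranspose_add, Matrix.conjTranspose_smul, h1,
        hse, hhalf, Matrix.conjTranspose_one, Matrix.smul_mul, Matrix.mul_smul, Matrix.add_mul,
        Matrix.mul_add, Matrix.one_mul, Matrix.one_mul, Matrix.mul_add, Matrix.mul_one,
        Matrix.smul_mul, Matrix.mul_smul, h2, smul_smul e e, hb]
      module
    rw [key]
    exact Matrix.posSemidef_conjTranspose_mul_self _
  sum_eq_one := by
    rw [Fin.sum_univ_two]
    simp only [Fin.val_zero, Fin.val_one, pow_zero, pow_one]
    module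

section OptimalAttack

variable {t : ℕ}

/-- The amplitudes, after `j` calls, of the superposition of the memory states `k` with weights
`a k`, where `k` has been charged with the phase `min k j` times. -/
noncomputable def pathKet (a : ℕ → ℝ) (z : ℂ) (j : ℕ) (p : Fin 2 × Fin (t + 1)) : ℂ :=
  if p.1 = (if j < (p.2 : ℕ) then 1 else 0) then (a p.2 : ℂ) * z ^ min (p.2 : ℕ) j else 0

/-- The initial state of the optimal attack. -/
noncomputable def pathDensity (a : ℕ → ℝ) (ha : ∑ k ∈ Finset.range (t + 1), a k ^ 2 = 1) :
    DensityOp (Fin 2 × Fin (t + 1)) where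
  mat := Matrix.vecMulVec (pathKet a 1 0) (star (pathKet a 1 0))
  posSemidef := Matrix.posSemidef_vecMulVec_self_star _
  trace_eq_one := by
    simp only [Matrix.trace, Matrix.diag_apply, Matrix.vecMulVec_apply, Pi.star_apply,
      Fintype.sum_prod_type_right, pathKet, one_pow, mul_one]
    rw [← Complex.ofReal_one, ← ha, ← Fin.sum_univ_eq_sum_range (fun k => a k ^ 2),
      Complex.ofReal_sum]
    refine Finset.sum_congr rfl fun k _ => ?_
    split_ifs <;> simp [sq]

/-- Flip the qubit when the memory holds `j + 1`. -/
def flipAt (j : ℕ) : Equiv.Perm (Fin 2 × Fin (t + 1)) :=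
  Function.Involutive.toPerm (fun p => if (p.2 : ℕ) = j + 1 then (1 - p.1, p.2) else p) (by
    intro p
    by_cases h : (p.2 : ℕ) = j + 1 <;> simp [h])

/-- The flip follows the black box, so the charge is read from the qubit before the flip. Branches k
≤ j are finished, k = j + 1 takes its last charge and is switched off, and larger k stay on. -/
lemma pathKet_succ (a : ℕ → ℝ) (z : ℂ) (j : ℕ) (p : Fin 2 × Fin (t + 1)) :
    pathKet a z (j + 1) p = z ^ ((flipAt j p).1 : ℕ) * pathKet a z j (flipAt j p) := by
  obtain ⟨q, k⟩ := p
  have hf : flipAt j (q, k) = if (k : ℕ) = j + 1 then (1 - q, k) else (q, k) := rfl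
  rw [hf]
  rcases lt_trichotomy (k : ℕ) (j + 1) with h | h | h
  · rw [if_neg h.ne]
    have h1 : ¬ j < (k : ℕ) := by omega
    have h2 : ¬ j + 1 < (k : ℕ) := by omega
    simp only [pathKet, h1, h2, if_false]
    rw [min_eq_left h.le, min_eq_left (Nat.lt_succ_iff.1 h)]
    fin_cases q <;> simp
  · rw [if_pos h]
    simp only [pathKet, h, lt_irrefl, if_false, Nat.lt_succ_self, if_true, min_self,
      min_eq_right (Nat.le_succ j)]
    fin_cases q <;> simp
    ring
  · rw [if_neg h.ne']
    have h1 : j < (k : ℕ) := by omega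
    simp only [pathKet, h1, h, if_true]
    rw [min_eq_right h.le, min_eq_right h1.le]
    fin_cases q <;> simp
    ring

/-- The circuit of the optimal attack. -/
noncomputable def pathPreparation (a : ℕ → ℝ)
    (ha : ∑ k ∈ Finset.range (t + 1), a k ^ 2 = 1) : (j : ℕ) → Preparation (t + 1) j
  | 0 => .init (pathDensity a ha)
  | j + 1 => .call (pathPreparation a ha j) (QuantumOp.ofPerm (flipAt j))

lemma pathPreparation_state (a : ℕ → ℝ) (ha : ∑ k ∈ Finset.range (t + 1), a k ^ 2 = 1) (φ : ℝ)
    (j : ℕ) : (pathPreparation a ha j).state φ =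
      Matrix.vecMulVec (pathKet a (Complex.exp (Complex.I * φ)) j)
        (star (pathKet a (Complex.exp (Complex.I * φ)) j)) := by
  induction j with
  | zero =>
    have h : pathKet (t := t) a (Complex.exp (Complex.I * φ)) 0 = pathKet a 1 0 := by
      funext p
      simp [pathKet]
    rw [h]
    rfl
  | succ j ih =>
    rw [pathPreparation, Preparation.state, QuantumOp.ofPerm_apply, ih]
    ext p q
    rw [Matrix.submatrix_apply, blackBox_apply, Matrix.vecMulVec_apply, Matrix.vecMulVec_apply,
      Pi.star_apply, Pi.star_apply, pathKet_succ a _ j p, pathKet_succ a _ j q, star_mul']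
    ring

/-- Exchange the memory state `k` next to Bob's `1` with its cyclic successor next to `0`. -/
def shiftSwap (t : ℕ) : Equiv.Perm ((Fin 2 × Fin (t + 1)) × Fin 2) :=
  Function.Involutive.toPerm (fun p => if p.2 = 1 then ((p.1.1, finRotate _ p.1.2), 0)
    else ((p.1.1, (finRotate _).symm p.1.2), 1)) (by
    rintro ⟨⟨q, k⟩, s⟩
    fin_cases s <;> simp)

lemma shiftSwap_involutive (t : ℕ) : Function.Involutive (shiftSwap t) :=
  Function.Involutive.toPerm_involutive _

/-- The optimal attack. -/
noncomputable def pathAttack (a : ℕ → ℝ) (ha : ∑ k ∈ Finset.range (t + 1), a k ^ 2 = 1) :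
    Attack t where
  dim := t + 1
  calls := t
  calls_le := le_rfl
  prep := pathPreparation a ha t
  measurement := .ofInvolution (shiftSwap t) (shiftSwap_involutive t)

lemma ofInvolution_shiftSwap_offDiagonal (r r' : Fin 2 × Fin (t + 1)) :
    (BitPOVM.ofInvolution (shiftSwap t) (shiftSwap_involutive t)).offDiagonal r r' =
      if r = (r'.1, finRotate _ r'.2) then 1 / 2 else 0 := by
  have h : shiftSwap t (r, 0) = ((r.1, (finRotate _).symm r.2), 1) := rfl
  have hr : ((r.1, (finRotate _).symm r.2) = r') = (r = (r'.1, finRotate _ r'.2)) := by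
    rw [eq_iff_iff, Prod.ext_iff, Prod.ext_iff, Equiv.symm_apply_eq]
  simp only [BitPOVM.offDiagonal, BitPOVM.ofInvolution, Matrix.submatrix_apply,
    Matrix.smul_apply, Matrix.add_apply, Matrix.one_apply, id, h, Prod.mk.injEq, Fin.val_zero,
    pow_zero, one_smul, smul_eq_mul, and_true, zero_ne_one, and_false, if_false, zero_add, hr]
  split_ifs <;> simp

lemma ofInvolution_shiftSwap_trace (ρ : Matrix (Fin 2 × Fin (t + 1)) (Fin 2 × Fin (t + 1)) ℂ) :
    ((BitPOVM.ofInvolution (shiftSwap t) (shiftSwap_involutive t)).offDiagonal * ρ).trace =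
      ∑ r, 1 / 2 * ρ r (r.1, finRotate _ r.2) := by
  rw [Matrix.trace_mul_comm]
  refine Finset.sum_congr rfl fun r _ => ?_
  rw [Matrix.diag_apply, Matrix.mul_apply, Finset.sum_eq_single (r.1, finRotate _ r.2)]
  · rw [ofInvolution_shiftSwap_offDiagonal, if_pos rfl, mul_comm]
  · intro r' _ hr'
    rw [ofInvolution_shiftSwap_offDiagonal, if_neg hr', mul_zero]
  · simp

/-- After t calls every branch has its qubit at 0 and phase power k. The exponent is 0 except at the
cyclic wraparound k = t. -/
lemma pathAttack_correctProb (a : ℕ → ℝ) (ha : ∑ k ∈ Finset.range (t + 1), a k ^ 2 = 1) (φ : ℝ) :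
    (pathAttack a ha).correctProb φ = 1 / 2 + ∑ k : Fin (t + 1),
      (((1 / 2 * (a k * a (finRotate _ k)) : ℝ) : ℂ) *
        Complex.exp (Complex.I * φ) ^ ((k : ℤ) + 1 - (finRotate _ k : ℕ))).re := by
  rw [Attack.correctProb_eq _ _ (Preparation.state_isHermitian _ _)]
  have hket : ∀ (z : ℂ) (q : Fin 2) (k : Fin (t + 1)),
      pathKet a z t (q, k) = if q = 0 then (a k : ℂ) * z ^ (k : ℕ) else 0 := by
    intro z q k
    have hk : (k : ℕ) ≤ t := Nat.lt_succ_iff.1 k.2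
    simp only [pathKet, hk.not_gt, if_false, min_eq_left hk]
  have htr : ((pathAttack a ha).measurement.offDiagonal *
      (pathAttack a ha).prep.state φ).trace = ∑ r' : Fin 2 × Fin (t + 1),
        1 / 2 * (pathKet a (Complex.exp (Complex.I * φ)) t r' *
          star (pathKet a (Complex.exp (Complex.I * φ)) t (r'.1, finRotate _ r'.2))) := by
    refine (ofInvolution_shiftSwap_trace ((pathPreparation a ha t).state φ)).trans ?_
    rw [pathPreparation_state]
    rfl
  rw [htr, Fintype.sum_prod_type, Fin.sum_univ_two]
  simp only [hket, if_true, one_ne_zero, if_false, zero_mul, mul_zero, Finset.sum_const_zero,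
    add_zero, Finset.mul_sum, Complex.re_sum]
  congr 1
  refine Finset.sum_congr rfl fun k _ => ?_
  congr 1
  rw [star_mul', star_pow, exp_I_mul_star, zpow_sub₀ (Complex.exp_ne_zero _),
    zpow_add₀ (Complex.exp_ne_zero _), zpow_natCast, zpow_natCast, zpow_one, Complex.star_def,
    Complex.conj_ofReal]
  push_cast
  ring

end OptimalAttack

lemma exists_attack_average_eq {M : (ℝ → ℝ) → ℝ} {d : ℕ} (t : ℕ) (hM : IsPhaseAverage M d)
    (htd : t + 1 ≤ d) :
    ∃ A : Attack t, M A.correctProb = 1 / 2 + 1 / 2 * Real.cos (Real.pi / ((t : ℝ) + 2)) := by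
  obtain ⟨a, ha, hcos⟩ := exists_path_eigenvector t
  refine ⟨pathAttack a ha, ?_⟩
  rw [funext (pathAttack_correctProb a ha), hM.const_add _ _ _ _ (by
    intro k _
    have h1 := k.2
    have h2 := (finRotate (t + 1) k).2
    rw [abs_le]
    omega), Fin.sum_univ_castSucc, ← hcos, ← Fin.sum_univ_eq_sum_range (fun k => a k * a (k + 1)),
    Finset.mul_sum]
  -- The wraparound term has frequency t + 1, so it averages to zero.
  have hlast : ((Fin.last t : ℕ) : ℤ) + 1 - ((finRotate (t + 1) (Fin.last t) : ℕ) : ℤ) ≠ 0 := by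
    rw [finRotate_last, Fin.val_last, Fin.val_zero]
    omega
  rw [if_neg hlast, add_zero]
  congr 1
  refine Finset.sum_congr rfl fun k _ => ?_
  have hk : finRotate (t + 1) k.castSucc = k.succ := by
    rw [finRotate_apply, Fin.coeSucc_eq_succ]
  rw [hk, if_pos (by simp), Complex.ofReal_re, Fin.val_castSucc, Fin.val_succ]

end PhaseKey

theorem mainTheorem2 :
    0 < Real.pi ^ 2 / 4 - Real.pi ^ 4 / 48 ∧
    (∀ r t : ℕ, 1 ≤ r → t + 1 ≤ 2 * r →
      IsGreatest (Set.range fun A : PhaseKey.Attack t => A.guessProb r)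
        (1 / 2 + 1 / 2 * Real.cos (Real.pi / ((t : ℝ) + 2))) ∧
      ∀ A : PhaseKey.Attack t, A.guessProb r ≤
        1 - (Real.pi ^ 2 / 4 - Real.pi ^ 4 / 48) / ((t : ℝ) + 2) ^ 2) ∧
    (∀ t : ℕ,
      IsGreatest (Set.range fun A : PhaseKey.Attack t => A.guessProbUniform)
        (1 / 2 + 1 / 2 * Real.cos (Real.pi / ((t : ℝ) + 2))) ∧
      ∀ A : PhaseKey.Attack t, A.guessProbUniform ≤
        1 - (Real.pi ^ 2 / 4 - Real.pi ^ 4 / 48) / ((t : ℝ) + 2) ^ 2) := by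
  refine ⟨PhaseKey.bound_constant_pos, fun r t _ htr => ?_, fun t => ?_⟩
  · have hM := PhaseKey.isPhaseAverage_discrete r
    have hle : ∀ A : PhaseKey.Attack t, A.guessProb r ≤ _ := fun A => A.average_le hM htr
    exact ⟨⟨PhaseKey.exists_attack_average_eq t hM htr, Set.forall_mem_range.2 hle⟩,
      fun A => (hle A).trans (PhaseKey.optimum_le t)⟩
  · have hM := PhaseKey.isPhaseAverage_uniform (t + 1)
    have hle : ∀ A : PhaseKey.Attack t, A.guessProbUniform ≤ _ := fun A => A.average_le hM le_rfl
    exact ⟨⟨PhaseKey.exists_attack_average_eq t hM le_rfl, Set.forall_mem_range.2 hle⟩,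
      fun A => (hle A).trans (PhaseKey.optimum_le t)⟩
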